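/- **Theorem 3.4.** Let $\lambda$ be a regular cardinal and let $\mathcal V$ be a symmetric monoidal closed category with unit $I$ which is locally $\lambda$-presentable as a symmetric monoidal closed category: the underlying category $\mathcal V_0$ is locally $\lambda$-presentable, $I$ is $\lambda$-presentable, and $X\otimes Y$ is $\lambda$-presentable whenever $X$ and $Y$ are. Let $K:\mathcal V_\lambda\to\mathcal V$ be the inclusion of the full sub-$\mathcal V$-category of $\lambda$-presentable objects. *Theories.* A $\mathcal V_\lambda$-pretheory is an identity-on-objects $\mathcal V$-functor $J:\mathcal V_\lambda\to\mathcal T$. A $\mathcal T$-algebra is an object $A$ of $\mathcal V$ with a $\mathcal V$-functor $\hat A:\mathcal T^{\mathrm{op}}\to\mathcal V$ such that $\hat A J^{\mathrm{op}}=\mathcal V(K-,A)$; these form a $\mathcal V$-category $\mathrm{Alg}(\mathcal T)$ with forgetful $\mathcal V$-functor $U:\mathrm{Alg}(\mathcal T)\to\mathcal V$. The pretheory is a $\lambda$-ary $\mathcal V$-theory if it is given by free $\mathcal T$-algebras over $\mathcal V_\lambda$: every $Y\in\mathcal V_\lambda$ has a free algebra $FY$ (in the enriched sense), and the canonical morphisms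 $\mathcal T(X,Y)\to\mathcal V(X,UFY)\cong\mathrm{Alg}(\mathcal T)(FX,FY)$ are isomorphisms for all $X,Y\in\mathcal V_\lambda$. *Discreteness.* For $X$ in $\mathcal V$ let $X_0=\mathcal V_0(I,X)\cdot I$ be the coproduct of $\mathcal V_0(I,X)$ copies of $I$, and let $\delta_X:X_0\to X$ be the morphism whose component at $x:I\to X$ is $x$. A morphism $f$ of $\mathcal V_0$ is a *surjection* if the map $\mathcal V_0(I,f)$ is surjective. Let $\mathcal T$ be a $\lambda$-ary $\mathcal V$-theory. Then $U$ has a left $\mathcal V$-adjoint $F$, and for every such $F$ the induced $\mathcal V$-monad $T=UF$ preserves $\lambda$-filtered colimits. Call $\mathcal T$ *discrete* if for every $\lambda$-presentable $X$ every morphism $f:JI\to JX$ of $\mathcal T$ factors through $J(\delta_X):JX_0\to JX$; here, as $X_0$ need not be $\lambda$-presentable, $J$ is extended to all objects by free algebras, that is, the condition is that the morphism $FI\to FX$ corresponding to $f$ equals $F(\delta_X)\,g$ for some $g:FI\to FX_0$ in $\mathrm{Alg}(\mathcal T)$. Then $$\mathcal T\text{ is discrete}\iff T\text{ preserves surjections}.$$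 In particular, if $X_0$ is $\lambda$-presentable for every $\lambda$-presentable $X$, then $T$ preserves surjections if and only if every morphism $JI\to JX$ of $\mathcal T$, with $X$ $\lambda$-presentable, equals $J(\delta_X)\,g$ for some morphism $g:JI\to JX_0$ of $\mathcal T$. -/

import Mathlib

open CategoryTheory CategoryTheory.Limits CategoryTheory.MonoidalCategory

universe w u

namespace DiscreteTheory

/-! ### The base of enrichment -/

section Base

variable (C : Type u) [Category.{w} C] [MonoidalCategory C] (κ : Cardinal.{w}) [Fact κ.IsRegular]

/-- Local `κ`-presentability of a (symmetric) monoidal (closed) category: the underlying category is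
locally `κ`-presentable, the unit object is `κ`-presentable, and the `κ`-presentable objects are
closed under the tensor product. -/
class IsLocallyPresentableMonoidal : Prop extends IsCardinalLocallyPresentable C κ where
  unit_presentable : IsCardinalPresentable (𝟙_ C) κ
  tensor_presentable (X Y : C) [IsCardinalPresentable X κ] [IsCardinalPresentable Y κ] :
    IsCardinalPresentable (X ⊗ Y) κ

/-- The arities: the (essentially small) full subcategory of `κ`-presentable objects. -/
abbrev Arity : Type u := (isCardinalPresentable C κ).FullSubcategory

/-- The unit object as an arity. -/
def Arity.unit [IsLocallyPresentableMonoidal C κ] : Arity C κ :=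
  ⟨𝟙_ C, IsLocallyPresentableMonoidal.unit_presentable⟩

/-- A surjection is a morphism `f` such that `C(I, f)` is a surjective map. -/
def surjections : MorphismProperty C :=
  fun A _ f ↦ Function.Surjective (fun x : 𝟙_ C ⟶ A ↦ x ≫ f)

/-- A functor preserves surjections if it sends surjections to surjections. -/
def PreservesSurjections (G : C ⥤ C) : Prop :=
  ∀ ⦃A B : C⦄ (f : A ⟶ B), surjections C f → surjections C (G.map f)

variable {C} [HasCoproducts.{w} C]

/-- The discrete object `X₀ = C(I, X) · I`, the coproduct of `C(I, X)` copies of the unit. -/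
noncomputable def discreteObj (X : C) : C := ∐ fun _ : 𝟙_ C ⟶ X ↦ 𝟙_ C

/-- The canonical morphism `δ_X : X₀ ⟶ X`, whose component at `x : I ⟶ X` is `x`. -/
noncomputable def δ (X : C) : discreteObj X ⟶ X := Sigma.desc fun x : 𝟙_ C ⟶ X ↦ x

end Base

/-! ### Pretheories and their algebras -/

variable (C : Type u) [Category.{w} C] [MonoidalCategory C] [MonoidalClosed C]
  (κ : Cardinal.{w}) [Fact κ.IsRegular]

/-- A pretheory with the `κ`-presentable objects as arities: a `C`-enriched category `𝒯` on the class
of arities together with an identity-on-objects `C`-functor `J` from the full sub-`C`-category of `C`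
on the arities (with hom-objects the internal homs) to `𝒯`. -/
structure Pretheory where
  /-- The `C`-category `𝒯`; its objects are the arities. -/
  cat : EnrichedCategory C (Arity C κ)
  /-- The action of `J` on hom-objects. -/
  J (X Y : Arity C κ) : (ihom X.obj).obj Y.obj ⟶ cat.Hom X Y
  J_id (X : Arity C κ) : MonoidalClosed.id X.obj ≫ J X X = cat.id X
  J_comp (X Y Z : Arity C κ) :
    MonoidalClosed.comp X.obj Y.obj Z.obj ≫ J X Z = (J X Y ⊗ₘ J Y Z) ≫ cat.comp X Y Z

variable {C κ}

namespace Pretheory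

variable (T : Pretheory C κ)

/-- The underlying morphism `J f : J X ⟶ J Y` in `𝒯` of a morphism `f : X ⟶ Y` between arities. -/
def mapJ {X Y : Arity C κ} (f : X.obj ⟶ Y.obj) : 𝟙_ C ⟶ T.cat.Hom X Y :=
  MonoidalClosed.curry' f ≫ T.J X Y

/-- Composition of morphisms in the underlying ordinary category of `𝒯`. -/
def underlyingComp {X Y Z : Arity C κ} (f : 𝟙_ C ⟶ T.cat.Hom X Y) (g : 𝟙_ C ⟶ T.cat.Hom Y Z) :
    𝟙_ C ⟶ T.cat.Hom X Z :=
  (λ_ (𝟙_ C)).inv ≫ (f ⊗ₘ g) ≫ T.cat.comp X Y Z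

/-- A `𝒯`-algebra: an object `A` of `C` with a `C`-functor `Â : 𝒯ᵒᵖ ⥤ C` such that `Â ∘ Jᵒᵖ` equals
`C(K -, A)`. Thus `Â X` is the internal hom `[X, A]`, and the effect of `Â` on hom-objects
`𝒯(X, Y) ⟶ [[Y, A], [X, A]]` is given by its transpose `act X Y : 𝒯(X, Y) ⊗ [Y, A] ⟶ [X, A]`.
The fields `id_act` and `comp_act` are functoriality of `Â`, and `J_act` says that `Â ∘ Jᵒᵖ` acts on
hom-objects in the same way as `C(K -, A)`, that is, by composition in `C`. -/
structure Algebra where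
  /-- The underlying object `A`. -/
  carrier : C
  /-- The (transposed) effect of the `C`-functor `Â` on hom-objects. -/
  act (X Y : Arity C κ) :
    T.cat.Hom X Y ⊗ (ihom Y.obj).obj carrier ⟶ (ihom X.obj).obj carrier
  id_act (X : Arity C κ) :
    (λ_ ((ihom X.obj).obj carrier)).inv ≫ T.cat.id X ▷ _ ≫ act X X = 𝟙 _
  comp_act (X Y Z : Arity C κ) :
    T.cat.comp X Y Z ▷ (ihom Z.obj).obj carrier ≫ act X Z =
      (α_ _ _ _).hom ≫ T.cat.Hom X Y ◁ act Y Z ≫ act X Y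
  J_act (X Y : Arity C κ) :
    T.J X Y ▷ (ihom Y.obj).obj carrier ≫ act X Y = MonoidalClosed.comp X.obj Y.obj carrier

namespace Algebra

variable {T}

/-- Morphisms of the underlying ordinary category of `Alg(𝒯)`: morphisms `f : A ⟶ B` of `C` such that
the morphisms `[X, f]` are natural in `X` with respect to `𝒯`. -/
@[ext]
structure Hom (A B : T.Algebra) where
  /-- The underlying morphism. -/
  hom : A.carrier ⟶ B.carrier
  comm (X Y : Arity C κ) :
    A.act X Y ≫ (ihom X.obj).map hom = T.cat.Hom X Y ◁ (ihom Y.obj).map hom ≫ B.act X Y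

instance : Category T.Algebra where
  Hom A B := Hom A B
  id A := { hom := 𝟙 _, comm := by intros; simp }
  comp f g :=
    { hom := f.hom ≫ g.hom
      comm := by
        intro X Y
        rw [Functor.map_comp, ← Category.assoc, f.comm, Category.assoc, g.comm]
        simp }

/-- `h : Z ⟶ [A, B]` corresponds to a morphism `Z ⟶ Alg(𝒯)(A, B)` into the hom-object of the
`C`-category `Alg(𝒯)`, i.e. to a family `Z ⟶ [[X, A], [X, B]]` which is `C`-natural in `X ∈ 𝒯` and is
induced by a single morphism `h`. Hence `Z ↦ {h : Z ⟶ [A, B] // IsGradedHom h}` is the functor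
represented by the hom-object `Alg(𝒯)(A, B)`; for `Z = I` one gets the ordinary morphisms above. -/
def IsGradedHom (A B : T.Algebra) {Z : C} (h : Z ⟶ (ihom A.carrier).obj B.carrier) : Prop :=
  ∀ X Y : Arity C κ,
    A.act X Y ▷ Z ≫ (_ ◁ h) ≫ MonoidalClosed.comp X.obj A.carrier B.carrier =
      (α_ _ _ _).hom ≫
        T.cat.Hom X Y ◁ ((_ ◁ h) ≫ MonoidalClosed.comp Y.obj A.carrier B.carrier) ≫ B.act X Y

/-- `F` is the free `𝒯`-algebra on `X` with unit `η : X ⟶ F`, in the enriched sense: for each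
algebra `A`, the canonical morphism `Alg(𝒯)(F, A) ⟶ [F, A] ⟶ [X, A]` is an isomorphism of `C`
(expressed on generalized elements of all shapes `Z`). -/
def IsFree (F : T.Algebra) {X : C} (η : X ⟶ F.carrier) : Prop :=
  ∀ (A : T.Algebra) (Z : C) (g : Z ⟶ (ihom X).obj A.carrier),
    ∃! h : Z ⟶ (ihom F.carrier).obj A.carrier,
      IsGradedHom F A h ∧ h ≫ (MonoidalClosed.pre η).app A.carrier = g

/-- Evaluation of the operations `𝒯(X, Y)` at an element `y : Y ⟶ A` of an algebra, as a morphism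
`𝒯(X, Y) ⟶ [X, A]` of `C`. -/
def eval (A : T.Algebra) (X Y : Arity C κ) (y : Y.obj ⟶ A.carrier) :
    T.cat.Hom X Y ⟶ (ihom X.obj).obj A.carrier :=
  (ρ_ _).inv ≫ T.cat.Hom X Y ◁ MonoidalClosed.curry' y ≫ A.act X Y

/-- The interpretation of an operation `f : J X ⟶ J Y` of `𝒯` in an algebra `A`, taking elements
`Y ⟶ A` to elements `X ⟶ A`. -/
def interp (A : T.Algebra) {X Y : Arity C κ} (f : 𝟙_ C ⟶ T.cat.Hom X Y)
    (y : Y.obj ⟶ A.carrier) : X.obj ⟶ A.carrier :=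
  MonoidalClosed.uncurry' (f ≫ A.eval X Y y)

end Algebra

/-- The underlying ordinary functor `U : Alg(𝒯) ⥤ C` of the forgetful `C`-functor. -/
def forget : T.Algebra ⥤ C where
  obj A := A.carrier
  map f := f.hom

/-- A pretheory is a theory if it is given by the free `𝒯`-algebras over the arities: each arity `Y`
has a free `𝒯`-algebra `FY`, and the canonical comparison morphism
`𝒯(X, Y) ⟶ [X, U F Y] ≅ Alg(𝒯)(FX, FY)`, evaluation of operations at the generic element
`η : Y ⟶ U F Y`, is an isomorphism for all arities `X`. -/
def IsTheory : Prop :=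
  ∀ Y : Arity C κ, ∃ (F : T.Algebra) (η : Y.obj ⟶ F.carrier),
    F.IsFree η ∧ ∀ X : Arity C κ, IsIso (F.eval X Y η)

/-- A left `C`-adjoint `F` of the forgetful `C`-functor `U : Alg(𝒯) ⥤ C`: a left adjoint on the
underlying ordinary categories for which the canonical morphisms `Alg(𝒯)(FX, A) ⟶ [X, U A]` are
isomorphisms of `C`. -/
structure FreeAlgebras where
  /-- The free algebra functor. -/
  F : C ⥤ T.Algebra
  /-- The ordinary adjunction. -/
  adj : F ⊣ T.forget
  isFree (X : C) : Algebra.IsFree (F.obj X) (adj.unit.app X)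

namespace FreeAlgebras

variable {T} (L : T.FreeAlgebras)

/-- The (underlying ordinary monad of the) `C`-monad `U F` on `C` induced by `𝒯`. -/
def monad : Monad C := L.adj.toMonad

/-- The morphism `FX ⟶ FY` of free algebras given by a morphism `J X ⟶ J Y` of `𝒯`. -/
def homOfOp {X Y : Arity C κ} (f : 𝟙_ C ⟶ T.cat.Hom X Y) :
    L.F.obj X.obj ⟶ L.F.obj Y.obj :=
  (L.adj.homEquiv X.obj (L.F.obj Y.obj)).symm
    ((L.F.obj Y.obj).interp f (L.adj.unit.app Y.obj))

end FreeAlgebras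

variable [IsLocallyPresentableMonoidal C κ] [HasCoproducts.{w} C]

/-- Discreteness of `𝒯`: each operation `J I ⟶ J X` factors through `J δ_X : J X₀ ⟶ J X`. Here `X₀`
need not be `κ`-presentable, so `J` is extended to all objects of `C` by free algebras: through the
embedding of `𝒯` as the full subcategory of `Alg(𝒯)` on the free algebras over the arities, the
factorization is one of morphisms `F I ⟶ F X₀ ⟶ F X` of `Alg(𝒯)`. -/
def IsDiscrete (L : T.FreeAlgebras) : Prop :=
  ∀ (X : Arity C κ) (f : 𝟙_ C ⟶ T.cat.Hom (Arity.unit C κ) X),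
    ∃ g : L.F.obj (𝟙_ C) ⟶ L.F.obj (discreteObj X.obj), g ≫ L.F.map (δ X.obj) = L.homOfOp f

/-- Discreteness of `𝒯`, expressed inside `𝒯`, when all `X₀` for `κ`-presentable `X` are again
`κ`-presentable: each `f : J I ⟶ J X` is a composite of some `g : J I ⟶ J X₀` with `J δ_X`. -/
def IsDiscreteInside (h : ∀ X : Arity C κ, IsCardinalPresentable (discreteObj X.obj) κ) : Prop :=
  ∀ (X : Arity C κ) (f : 𝟙_ C ⟶ T.cat.Hom (Arity.unit C κ) X),
    ∃ g : 𝟙_ C ⟶ T.cat.Hom (Arity.unit C κ) ⟨discreteObj X.obj, h X⟩,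
      T.underlyingComp g (T.mapJ (X := ⟨discreteObj X.obj, h X⟩) (Y := X) (δ X.obj)) = f

end Pretheory

end DiscreteTheory

/-!
Since the `κ`-presentable objects are closed under `⊗`, the internal homs `[X, -]` out of arities
preserve `κ`-filtered colimits, so `κ`-filtered colimits of algebras are created by `U`. Every
object is a `κ`-filtered colimit of arities; hence free algebras on arities extend to all objects,
enriched freeness being inherited because `[-, A]` turns these colimits into limits, and `T = UF`
preserves `κ`-filtered colimits.

Therefore an element of `T B` comes from `T X` for some arity `X ⟶ B`. If `A ⟶ B` is a surjection,
the composite `X₀ ⟶ X ⟶ B` lifts to `A`, so `T` preserves surjections as soon as each `T δ_X` is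
one; the converse holds because `δ_X` is itself a surjection. In a theory the operations
`J I ⟶ J X` are the elements of `T X`, so surjectivity of all `T δ_X` is exactly discreteness.
-/

namespace DiscreteTheory

section Accessibility

universe v u₁ u₂

variable {C : Type u₁} [Category.{v} C] {D : Type u₂} [Category.{v} D] {κ : Cardinal.{w}}
  [Fact κ.IsRegular] [IsCardinalAccessibleCategory D κ]

variable (κ) in
lemma isIso_of_isIso_coyoneda_map {A B : D} (f : A ⟶ B)
    (hf : ∀ (X : D) [IsCardinalPresentable X κ], IsIso ((coyoneda.obj (.op X)).map f)) :
    IsIso f := by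
  have hD := (isCardinalFilteredGenerator_isCardinalPresentable D κ).isStrongGenerator
  have hf' (X : D) (hX : isCardinalPresentable D κ X) :
      Function.Bijective fun g : X ⟶ A ↦ g ≫ f := by
    rw [isCardinalPresentable_iff] at hX
    exact (isIso_iff_bijective ((coyoneda.obj (.op X)).map f)).1 (hf X)
  have : Mono f := (hD.isSeparating.mono_iff f).2 fun X hX _ _ h ↦ (hf' X hX).injective h
  exact hD.isIso_of_mono f fun X hX ↦ (hf' X hX).surjective

lemma isCardinalAccessible_of_comp_coyoneda (F : C ⥤ D)
    (hF : ∀ (X : D) [IsCardinalPresentable X κ],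
      (F ⋙ coyoneda.obj (.op X)).IsCardinalAccessible κ) :
    F.IsCardinalAccessible κ where
  preservesColimitOfShape J _ _ := by
    have := HasCardinalFilteredColimits.hasColimitsOfShape D κ J
    refine ⟨fun {K} ↦ ⟨fun {c} hc ↦ ⟨?_⟩⟩⟩
    let φ : colimit.cocone (K ⋙ F) ⟶ F.mapCocone c := colimit.coconeMorphism _
    have : IsIso φ.hom := isIso_of_isIso_coyoneda_map κ φ.hom fun X _ ↦ by
      have := (F ⋙ coyoneda.obj (.op X)).preservesColimitsOfShape_of_isCardinalAccessible κ J
      have := preservesColimitsOfShape_of_isCardinalPresentable X κ J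
      have h₁ := isColimitOfPreserves (coyoneda.obj (.op X)) (colimit.isColimit (K ⋙ F))
      have h₂ := isColimitOfPreserves (F ⋙ coyoneda.obj (.op X)) hc
      have := h₁.hom_isIso h₂ ((Cocone.functoriality _ (coyoneda.obj (.op X))).map φ)
      exact inferInstanceAs <|
        IsIso ((Cocone.forget _).map ((Cocone.functoriality _ (coyoneda.obj (.op X))).map φ))
    exact (colimit.isColimit (K ⋙ F)).ofIsoColimit (Cocone.ext (asIso φ.hom) φ.w)

lemma isCardinalAccessible_rightAdjoint {L : D ⥤ C} {R : C ⥤ D} (adj : L ⊣ R)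
    (hL : ∀ (X : D) [IsCardinalPresentable X κ], IsCardinalPresentable (L.obj X) κ) :
    R.IsCardinalAccessible κ :=
  isCardinalAccessible_of_comp_coyoneda R fun X _ ↦
    have := hL X
    Functor.isCardinalAccessible_of_natIso (adj.compCoyonedaIso.app (.op X)) κ

end Accessibility

section InternalHom

variable {C : Type u} [Category.{w} C] [MonoidalCategory C] [MonoidalClosed C]

instance (κ : Cardinal.{w}) [Fact κ.IsRegular] [IsLocallyPresentableMonoidal C κ]
    (X : Arity C κ) : (ihom X.obj).IsCardinalAccessible κ :=
  isCardinalAccessible_rightAdjoint (ihom.adjunction X.obj) fun Y _ ↦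
    IsLocallyPresentableMonoidal.tensor_presentable X.obj Y

instance (κ : Cardinal.{w}) [Fact κ.IsRegular] [IsLocallyPresentableMonoidal C κ] (K : Type w)
    [SmallCategory K] [IsCardinalFiltered K κ] (Y : Arity C κ) :
    PreservesColimitsOfShape K (ihom Y.obj) :=
  (ihom Y.obj).preservesColimitsOfShape_of_isCardinalAccessible κ K

lemma pre_app_pre_app {X Y W Z A : C} (f : X ⟶ Y) (g : Y ⟶ W) (h : Z ⟶ (ihom W).obj A) :
    (h ≫ (MonoidalClosed.pre g).app A) ≫ (MonoidalClosed.pre f).app A =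
      h ≫ (MonoidalClosed.pre (f ≫ g)).app A := by
  simp

lemma curry'_pre_app {X Y A : C} (f : X ⟶ Y) (g : Y ⟶ A) :
    MonoidalClosed.curry' g ≫ (MonoidalClosed.pre f).app A = MonoidalClosed.curry' (f ≫ g) := by
  rw [MonoidalClosed.curry', MonoidalClosed.curry_pre_app, rightUnitor_naturality_assoc,
    MonoidalClosed.curry']

lemma whiskerLeft_ihom_map_comp (X Y : C) {A B : C} (f : A ⟶ B) :
    (ihom X).obj Y ◁ (ihom Y).map f ≫ MonoidalClosed.comp X Y B =
      MonoidalClosed.comp X Y A ≫ (ihom X).map f := by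
  apply MonoidalClosed.uncurry_injective
  rw [MonoidalClosed.uncurry_natural_left, MonoidalClosed.uncurry_natural_right,
    MonoidalClosed.comp_eq, MonoidalClosed.comp_eq, MonoidalClosed.uncurry_curry,
    MonoidalClosed.uncurry_curry, MonoidalClosed.compTranspose_eq,
    MonoidalClosed.compTranspose_eq]
  rw [associator_inv_naturality_right_assoc, whisker_exchange_assoc, Category.assoc,
    Category.assoc]
  exact congr(_ ≫ _ ≫ $(ihom.ev_naturality Y f))

lemma whiskerLeft_pre_comp (X : C) {A A' : C} (B : C) (f : A ⟶ A') :
    (ihom X).obj A ◁ (MonoidalClosed.pre f).app B ≫ MonoidalClosed.comp X A B =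
      (ihom X).map f ▷ (ihom A').obj B ≫ MonoidalClosed.comp X A' B := by
  apply MonoidalClosed.uncurry_injective
  rw [MonoidalClosed.uncurry_natural_left, MonoidalClosed.uncurry_natural_left,
    MonoidalClosed.comp_eq, MonoidalClosed.comp_eq, MonoidalClosed.uncurry_curry,
    MonoidalClosed.uncurry_curry, MonoidalClosed.compTranspose_eq,
    MonoidalClosed.compTranspose_eq, associator_inv_naturality_right_assoc,
    whisker_exchange_assoc, associator_inv_naturality_middle_assoc, ← comp_whiskerRight_assoc,
    ihom.ev_naturality, comp_whiskerRight_assoc]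
  exact congr(_ ≫ _ ≫ $(MonoidalClosed.id_tensor_pre_app_comp_ev f B))

variable {K : Type*} [Category* K] [∀ Z : C, PreservesColimitsOfShape K (tensorRight Z)]

instance (A : C) : PreservesLimitsOfShape Kᵒᵖ (MonoidalClosed.internalHom.flip.obj A) := by
  have (Z : C) : PreservesColimitsOfShape K ((curriedTensor C).flip.obj Z) :=
    inferInstanceAs (PreservesColimitsOfShape K (tensorRight Z))
  have (Z : C) : PreservesColimitsOfShape Kᵒᵖᵒᵖ ((curriedTensor C).flip.obj Z) :=
    preservesColimitsOfShape_of_equiv (opOpEquivalence K).symm _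
  exact MonoidalClosed.internalHomAdjunction₂.preservesLimitsOfShape_flip_obj _ A

variable {G : K ⥤ C} {c : Cocone G} (hc : IsColimit c) {Z A : C}

include hc

lemma exists_pre_eq (f : ∀ k, Z ⟶ (ihom (G.obj k)).obj A)
    (hf : ∀ ⦃k l : K⦄ (u : k ⟶ l), f l ≫ (MonoidalClosed.pre (G.map u)).app A = f k) :
    ∃ g : Z ⟶ (ihom c.pt).obj A, ∀ k, g ≫ (MonoidalClosed.pre (c.ι.app k)).app A = f k :=
  have h := isLimitOfPreserves (MonoidalClosed.internalHom.flip.obj A) hc.op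
  let s : Cone (G.op ⋙ MonoidalClosed.internalHom.flip.obj A) :=
    { pt := Z
      π.app k := f k.unop
      π.naturality _ _ u := (Category.id_comp _).trans (hf u.unop).symm }
  ⟨h.lift s, fun k ↦ h.fac s (.op k)⟩

lemma pre_hom_ext {f g : Z ⟶ (ihom c.pt).obj A}
    (h : ∀ k, f ≫ (MonoidalClosed.pre (c.ι.app k)).app A =
      g ≫ (MonoidalClosed.pre (c.ι.app k)).app A) : f = g :=
  (isLimitOfPreserves (MonoidalClosed.internalHom.flip.obj A) hc.op).hom_ext fun k ↦ h k.unop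

end InternalHom

namespace Pretheory

variable {C : Type u} [Category.{w} C] [MonoidalCategory C] [MonoidalClosed C]
  {κ : Cardinal.{w}} [Fact κ.IsRegular] {T : Pretheory C κ}

namespace Algebra

@[simp]
lemma comp_hom {A B D : T.Algebra} (f : A ⟶ B) (g : B ⟶ D) : (f ≫ g).hom = f.hom ≫ g.hom := rfl

lemma hom_ext {A B : T.Algebra} {f g : A ⟶ B} (h : f.hom = g.hom) : f = g :=
  Hom.ext h

lemma hom_comm {A B : T.Algebra} (f : A ⟶ B) (X Y : Arity C κ) :
    A.act X Y ≫ (ihom X.obj).map f.hom = T.cat.Hom X Y ◁ (ihom Y.obj).map f.hom ≫ B.act X Y :=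
  f.comm X Y

instance {A B : T.Algebra} (f : A ⟶ B) [IsIso f] : IsIso f.hom :=
  inferInstanceAs (IsIso (T.forget.map f))

instance : T.forget.ReflectsIsomorphisms where
  reflects {A B} f hf := by
    have : IsIso f.hom := hf
    have inv_comm (X Y : Arity C κ) : B.act X Y ≫ (ihom X.obj).map (inv f.hom) =
        T.cat.Hom X Y ◁ (ihom Y.obj).map (inv f.hom) ≫ A.act X Y := by
      rw [← cancel_epi (T.cat.Hom X Y ◁ (ihom Y.obj).map f.hom), ← reassoc_of% hom_comm f X Y]
      simp [← whiskerLeft_comp_assoc]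
    exact ⟨Hom.mk _ inv_comm, hom_ext (IsIso.hom_inv_id f.hom), hom_ext (IsIso.inv_hom_id f.hom)⟩

/-- The action of `𝒯(X, Y)` on algebras, as a natural transformation. -/
def actNatTrans (T : Pretheory C κ) (X Y : Arity C κ) :
    T.forget ⋙ ihom Y.obj ⋙ tensorLeft (T.cat.Hom X Y) ⟶ T.forget ⋙ ihom X.obj where
  app A := A.act X Y
  naturality _ _ f := (hom_comm f X Y).symm

section Colimit

variable {K : Type*} [Category* K] [∀ Y : Arity C κ, PreservesColimitsOfShape K (ihom Y.obj)]
  (D : K ⥤ T.Algebra) {c : Cocone (D ⋙ T.forget)} (hc : IsColimit c)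

/-- The coprojection `c.ι.app k`, typed with `(D.obj k).carrier` as its source. -/
def leg (c : Cocone (D ⋙ T.forget)) (k : K) : (D.obj k).carrier ⟶ c.pt := c.ι.app k

include hc in
lemma leg_hom_ext {P W : C} {Y : Arity C κ} {f g : P ⊗ (ihom Y.obj).obj c.pt ⟶ W}
    (h : ∀ k, P ◁ (ihom Y.obj).map (leg D c k) ≫ f =
      P ◁ (ihom Y.obj).map (leg D c k) ≫ g) : f = g :=
  (isColimitOfPreserves (ihom Y.obj ⋙ tensorLeft P) hc).hom_ext h

/-- The operations on a colimit of carriers of algebras. -/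
noncomputable def colimitAct (X Y : Arity C κ) :
    T.cat.Hom X Y ⊗ (ihom Y.obj).obj c.pt ⟶ (ihom X.obj).obj c.pt :=
  (isColimitOfPreserves (ihom Y.obj ⋙ tensorLeft (T.cat.Hom X Y)) hc).map
    ((ihom X.obj).mapCocone c) (D.whiskerLeft (actNatTrans T X Y))

lemma leg_colimitAct (X Y : Arity C κ) (k : K) :
    T.cat.Hom X Y ◁ (ihom Y.obj).map (leg D c k) ≫ colimitAct D hc X Y =
      (D.obj k).act X Y ≫ (ihom X.obj).map (leg D c k) :=
  (isColimitOfPreserves (ihom Y.obj ⋙ tensorLeft (T.cat.Hom X Y)) hc).ι_map _ _ k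

/-- The algebra structure on a colimit of carriers of algebras. -/
noncomputable def colimitAlgebra : T.Algebra where
  carrier := c.pt
  act X Y := colimitAct D hc X Y
  id_act X := by
    rw [← cancel_epi (λ_ _).hom]
    refine leg_hom_ext D hc fun k ↦ ?_
    rw [Iso.hom_inv_id_assoc, whisker_exchange_assoc, leg_colimitAct, Category.comp_id,
      leftUnitor_naturality, ← cancel_epi (λ_ _).inv, reassoc_of% (D.obj k).id_act X,
      Iso.inv_hom_id_assoc]
  comp_act X Y Z := by
    refine leg_hom_ext D hc fun k ↦ ?_
    rw [whisker_exchange_assoc, leg_colimitAct, reassoc_of% (D.obj k).comp_act X Y Z,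
      associator_naturality_right_assoc, ← whiskerLeft_comp_assoc, leg_colimitAct,
      whiskerLeft_comp_assoc, leg_colimitAct]
  J_act X Y := by
    refine leg_hom_ext D hc fun k ↦ ?_
    rw [whisker_exchange_assoc, leg_colimitAct, reassoc_of% (D.obj k).J_act X Y,
      whiskerLeft_ihom_map_comp]

lemma colimitAct_ihom_map {B : T.Algebra} (f : ∀ k, D.obj k ⟶ B) {d : c.pt ⟶ B.carrier}
    (hd : ∀ k, leg D c k ≫ d = (f k).hom) (X Y : Arity C κ) :
    colimitAct D hc X Y ≫ (ihom X.obj).map d =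
      T.cat.Hom X Y ◁ (ihom Y.obj).map d ≫ B.act X Y := by
  refine leg_hom_ext D hc fun k ↦ ?_
  rw [reassoc_of% leg_colimitAct D hc X Y k, ← Functor.map_comp, hd, ← whiskerLeft_comp_assoc,
    ← Functor.map_comp, hd, hom_comm]

/-- The cocone of algebras with point `colimitAlgebra` lying over a colimit cocone of carriers. -/
noncomputable def colimitCocone : Cocone D where
  pt := colimitAlgebra D hc
  ι.app k := Hom.mk (B := colimitAlgebra D hc) (leg D c k) fun X Y ↦
    (leg_colimitAct D hc X Y k).symm
  ι.naturality _ _ u := hom_ext (c.ι.naturality u)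

noncomputable def isColimitColimitCocone : IsColimit (colimitCocone D hc) where
  desc s := Hom.mk (A := colimitAlgebra D hc) (hc.desc (T.forget.mapCocone s))
    (colimitAct_ihom_map D hc s.ι.app (hc.fac (T.forget.mapCocone s)))
  fac s k := hom_ext (hc.fac (T.forget.mapCocone s) k)
  uniq s _ hm := hom_ext (hc.uniq (T.forget.mapCocone s) _ fun k ↦ congr(Hom.hom $(hm k)))

end Colimit

end Algebra

noncomputable instance {K : Type*} [Category* K]
    [∀ Y : Arity C κ, PreservesColimitsOfShape K (ihom Y.obj)] :
    CreatesColimitsOfShape K T.forget where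
  CreatesColimit {D} := createsColimitOfReflectsIso fun _ hc ↦
    { liftedCocone := Algebra.colimitCocone D hc
      validLift := Cocone.ext (Iso.refl _) fun _ ↦ Category.comp_id _
      makesColimit := Algebra.isColimitColimitCocone D hc }

namespace Algebra

section Graded

variable {A A' B : T.Algebra} {Z : C}

/-- The side of the equation in `IsGradedHom` on which `𝒯(X, Y)` acts on `A` before composition
with `h`. -/
def actThenComp (A B : T.Algebra) {Z : C} (h : Z ⟶ (ihom A.carrier).obj B.carrier)
    (X Y : Arity C κ) :
    (T.cat.Hom X Y ⊗ (ihom Y.obj).obj A.carrier) ⊗ Z ⟶ (ihom X.obj).obj B.carrier :=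
  A.act X Y ▷ Z ≫ (_ ◁ h) ≫ MonoidalClosed.comp X.obj A.carrier B.carrier

/-- The side of the equation in `IsGradedHom` on which `𝒯(X, Y)` acts on `B` after composition
with `h`. -/
def compThenAct (A B : T.Algebra) {Z : C} (h : Z ⟶ (ihom A.carrier).obj B.carrier)
    (X Y : Arity C κ) :
    (T.cat.Hom X Y ⊗ (ihom Y.obj).obj A.carrier) ⊗ Z ⟶ (ihom X.obj).obj B.carrier :=
  (α_ _ _ _).hom ≫
    T.cat.Hom X Y ◁ ((_ ◁ h) ≫ MonoidalClosed.comp Y.obj A.carrier B.carrier) ≫ B.act X Y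

lemma whiskerRight_actThenComp (f : A ⟶ A') (h : Z ⟶ (ihom A'.carrier).obj B.carrier)
    (X Y : Arity C κ) :
    (T.cat.Hom X Y ◁ (ihom Y.obj).map f.hom) ▷ Z ≫ actThenComp A' B h X Y =
      actThenComp A B (h ≫ (MonoidalClosed.pre f.hom).app B.carrier) X Y := by
  rw [actThenComp, actThenComp, ← comp_whiskerRight_assoc, ← hom_comm, whiskerLeft_comp_assoc,
    whiskerLeft_pre_comp, comp_whiskerRight_assoc, whisker_exchange_assoc]

lemma whiskerRight_compThenAct (f : A ⟶ A') (h : Z ⟶ (ihom A'.carrier).obj B.carrier)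
    (X Y : Arity C κ) :
    (T.cat.Hom X Y ◁ (ihom Y.obj).map f.hom) ▷ Z ≫ compThenAct A' B h X Y =
      compThenAct A B (h ≫ (MonoidalClosed.pre f.hom).app B.carrier) X Y := by
  rw [compThenAct, compThenAct, whiskerLeft_comp (ihom Y.obj |>.obj A.carrier), Category.assoc,
    whiskerLeft_pre_comp, associator_naturality_middle_assoc, ← whiskerLeft_comp_assoc,
    whisker_exchange_assoc]

lemma IsGradedHom.comp_pre {h : Z ⟶ (ihom A'.carrier).obj B.carrier} (hh : IsGradedHom A' B h)
    (f : A ⟶ A') : IsGradedHom A B (h ≫ (MonoidalClosed.pre f.hom).app B.carrier) := fun X Y ↦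
  (whiskerRight_actThenComp f h X Y).symm.trans
    (congr(_ ≫ $(hh X Y)).trans (whiskerRight_compThenAct f h X Y))

lemma IsGradedHom.of_isColimit {K : Type*} [Category* K]
    [∀ Y : Arity C κ, PreservesColimitsOfShape K (ihom Y.obj)]
    [∀ Z : C, PreservesColimitsOfShape K (tensorRight Z)] {D : K ⥤ T.Algebra} {s : Cocone D}
    (hs : IsColimit (T.forget.mapCocone s)) {h : Z ⟶ (ihom s.pt.carrier).obj B.carrier}
    (hh : ∀ k, IsGradedHom (D.obj k) B
      (h ≫ (MonoidalClosed.pre (s.ι.app k).hom).app B.carrier)) :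
    IsGradedHom s.pt B h := fun X Y ↦
  (isColimitOfPreserves ((ihom Y.obj ⋙ tensorLeft (T.cat.Hom X Y)) ⋙ tensorRight Z) hs).hom_ext
    fun k ↦ (whiskerRight_actThenComp (s.ι.app k) h X Y).trans
      ((hh k X Y).trans (whiskerRight_compThenAct (s.ι.app k) h X Y).symm)

lemma isGradedHom_curry'_iff (f : A.carrier ⟶ B.carrier) :
    IsGradedHom A B (MonoidalClosed.curry' f) ↔ ∀ X Y : Arity C κ,
      A.act X Y ≫ (ihom X.obj).map f = T.cat.Hom X Y ◁ (ihom Y.obj).map f ≫ B.act X Y := by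
  refine forall₂_congr fun X Y ↦ ?_
  rw [MonoidalClosed.whiskerLeft_curry'_comp, MonoidalClosed.whiskerLeft_curry'_comp,
    rightUnitor_naturality_assoc, whiskerLeft_comp_assoc, ← rightUnitor_tensor_hom_assoc,
    cancel_epi]

end Graded

namespace IsFree

variable {F F' : T.Algebra} {X : C} {η : X ⟶ F.carrier}

lemma existsUnique_hom (hF : F.IsFree η) (A : T.Algebra) (y : X ⟶ A.carrier) :
    ∃! f : F ⟶ A, η ≫ f.hom = y := by
  obtain ⟨h, ⟨h_graded, h_pre⟩, h_unique⟩ := hF A (𝟙_ C) (MonoidalClosed.curry' y)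
  obtain ⟨f, rfl⟩ := MonoidalClosed.curryHomEquiv'.surjective h
  refine ⟨Hom.mk f ((isGradedHom_curry'_iff f).1 h_graded),
    MonoidalClosed.curry'_injective ((curry'_pre_app η f).symm.trans h_pre), fun g hg ↦ ?_⟩
  refine hom_ext (MonoidalClosed.curry'_injective (h_unique _ ⟨?_, ?_⟩))
  · exact (isGradedHom_curry'_iff _).2 (hom_comm g)
  · rw [curry'_pre_app, hg]

/-- The universal property of a free algebra among ordinary algebra morphisms. -/
noncomputable def corepresentableBy (hF : F.IsFree η) :
    (T.forget ⋙ coyoneda.obj (.op X)).CorepresentableBy F where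
  homEquiv {A} := Equiv.ofBijective (fun f ↦ η ≫ f.hom)
    ((Function.bijective_iff_existsUnique _).2 (hF.existsUnique_hom A))
  homEquiv_comp g f := (Category.assoc η f.hom g.hom).symm

lemma of_iso (hF : F.IsFree η) (e : F ≅ F') : F'.IsFree (η ≫ e.hom.hom) := fun A Z g ↦ by
  obtain ⟨h, ⟨h_graded, h_pre⟩, h_unique⟩ := hF A Z g
  have hom_inv : e.hom.hom ≫ e.inv.hom = 𝟙 _ := congr(Hom.hom $(e.hom_inv_id))
  have inv_hom : e.inv.hom ≫ e.hom.hom = 𝟙 _ := congr(Hom.hom $(e.inv_hom_id))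
  refine ⟨h ≫ (MonoidalClosed.pre e.inv.hom).app A.carrier, ⟨h_graded.comp_pre e.inv, ?_⟩,
    fun h' ⟨h'_graded, h'_pre⟩ ↦ ?_⟩
  · rw [pre_app_pre_app, Category.assoc, hom_inv, Category.comp_id, h_pre]
  · rw [← h_unique _ ⟨h'_graded.comp_pre e.hom, (pre_app_pre_app ..).trans h'_pre⟩,
      pre_app_pre_app, inv_hom, MonoidalClosed.pre_id, NatTrans.id_app, Category.comp_id]

lemma exists_iso_of_adjunction (hF : F.IsFree η) {L : C ⥤ T.Algebra} (adj : L ⊣ T.forget) :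
    ∃ e : F ≅ L.obj X, η ≫ e.hom.hom = adj.unit.app X :=
  ⟨hF.corepresentableBy.uniqueUpToIso (adj.corepresentableBy X),
    (hF.corepresentableBy.homEquiv.apply_symm_apply _).trans
      ((adj.homEquiv_unit _ _ _).trans (Category.comp_id _))⟩

lemma of_isColimit {K : Type*} [Category* K]
    [∀ Y : Arity C κ, PreservesColimitsOfShape K (ihom Y.obj)]
    [∀ Z : C, PreservesColimitsOfShape K (tensorRight Z)]
    {R : K ⥤ C} {c : Cocone R} (hc : IsColimit c) {D : K ⥤ T.Algebra} {s : Cocone D}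
    (hs : IsColimit (T.forget.mapCocone s)) (η : ∀ k, R.obj k ⟶ (D.obj k).carrier)
    (hη : ∀ ⦃k l : K⦄ (u : k ⟶ l), η k ≫ (D.map u).hom = R.map u ≫ η l)
    (η' : c.pt ⟶ s.pt.carrier) (hη' : ∀ k, η k ≫ (s.ι.app k).hom = c.ι.app k ≫ η')
    (hD : ∀ k, (D.obj k).IsFree (η k)) : s.pt.IsFree η' := fun A Z g ↦ by
  choose f hf f_unique using
    fun k ↦ hD k A Z (g ≫ (MonoidalClosed.pre (c.ι.app k)).app A.carrier)
  have f_compatible ⦃k l : K⦄ (u : k ⟶ l) :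
      f l ≫ (MonoidalClosed.pre (D.map u).hom).app A.carrier = f k := by
    refine f_unique k _ ⟨(hf l).1.comp_pre (D.map u), ?_⟩
    rw [pre_app_pre_app, hη, ← pre_app_pre_app, (hf l).2, pre_app_pre_app, c.w]
  have restrict (h : Z ⟶ (ihom s.pt.carrier).obj A.carrier) (k : K) :
      (h ≫ (MonoidalClosed.pre (s.ι.app k).hom).app A.carrier) ≫
          (MonoidalClosed.pre (η k)).app A.carrier =
        (h ≫ (MonoidalClosed.pre η').app A.carrier) ≫
          (MonoidalClosed.pre (c.ι.app k)).app A.carrier := by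
    rw [pre_app_pre_app, pre_app_pre_app, hη']
  obtain ⟨d, hd⟩ : ∃ d : Z ⟶ (ihom s.pt.carrier).obj A.carrier,
      ∀ k, d ≫ (MonoidalClosed.pre (s.ι.app k).hom).app A.carrier = f k :=
    exists_pre_eq hs f f_compatible
  refine ⟨d, ⟨.of_isColimit hs fun k ↦ (hd k).symm ▸ (hf k).1, ?_⟩, fun d' ⟨hd', hd'g⟩ ↦ ?_⟩
  · exact pre_hom_ext hc fun k ↦ by rw [← restrict, hd, (hf k).2]
  · refine pre_hom_ext hs fun k ↦ Eq.trans ?_ (hd k).symm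
    exact f_unique k _ ⟨hd'.comp_pre (s.ι.app k), (restrict d' k).trans congr($hd'g ≫ _)⟩

end IsFree

end Algebra

section Interpretation

namespace Algebra

variable {A B : T.Algebra} {X Y Z : Arity C κ}

lemma eval_naturality (φ : A ⟶ B) (y : Y.obj ⟶ A.carrier) :
    A.eval X Y y ≫ (ihom X.obj).map φ.hom = B.eval X Y (y ≫ φ.hom) := by
  rw [eval, eval, Category.assoc, Category.assoc, hom_comm, ← whiskerLeft_comp_assoc,
    MonoidalClosed.curry'_ihom_map]

lemma interp_naturality (φ : A ⟶ B) (f : 𝟙_ C ⟶ T.cat.Hom X Y) (y : Y.obj ⟶ A.carrier) :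
    A.interp f y ≫ φ.hom = B.interp f (y ≫ φ.hom) := by
  apply MonoidalClosed.curry'_injective
  rw [interp, interp, ← MonoidalClosed.curry'_ihom_map, MonoidalClosed.curry'_uncurry',
    MonoidalClosed.curry'_uncurry', Category.assoc, eval_naturality]

lemma curry'_interp (f : 𝟙_ C ⟶ T.cat.Hom X Y) (y : Y.obj ⟶ A.carrier) :
    MonoidalClosed.curry' (A.interp f y) =
      (λ_ (𝟙_ C)).inv ≫ (f ⊗ₘ MonoidalClosed.curry' y) ≫ A.act X Y := by
  rw [interp, eval, MonoidalClosed.curry'_uncurry', rightUnitor_inv_naturality_assoc,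
    unitors_inv_equal, tensorHom_def_assoc]

lemma interp_mapJ (f : X.obj ⟶ Y.obj) (y : Y.obj ⟶ A.carrier) :
    A.interp (T.mapJ f) y = f ≫ y := by
  apply MonoidalClosed.curry'_injective
  rw [curry'_interp, MonoidalClosed.curry'_comp, ← A.J_act, mapJ, tensorHom_def_assoc,
    tensorHom_def_assoc, comp_whiskerRight_assoc, whisker_exchange_assoc]

lemma interp_underlyingComp (f : 𝟙_ C ⟶ T.cat.Hom X Y) (g : 𝟙_ C ⟶ T.cat.Hom Y Z)
    (z : Z.obj ⟶ A.carrier) :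
    A.interp (T.underlyingComp f g) z = A.interp f (A.interp g z) := by
  apply MonoidalClosed.curry'_injective
  have comp_tensor : T.underlyingComp f g ⊗ₘ MonoidalClosed.curry' z =
      (λ_ (𝟙_ C)).inv ▷ 𝟙_ C ≫ ((f ⊗ₘ g) ⊗ₘ MonoidalClosed.curry' z) ≫
        T.cat.comp X Y Z ▷ _ := by
    simp only [underlyingComp, ← tensorHom_id, tensorHom_comp_tensorHom, Category.id_comp,
      Category.comp_id]
  have tensor_act : f ⊗ₘ ((λ_ (𝟙_ C)).inv ≫ (g ⊗ₘ MonoidalClosed.curry' z) ≫ A.act Y Z) =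
      𝟙_ C ◁ (λ_ (𝟙_ C)).inv ≫ (f ⊗ₘ (g ⊗ₘ MonoidalClosed.curry' z)) ≫
        T.cat.Hom X Y ◁ A.act Y Z := by
    simp only [← id_tensorHom, tensorHom_comp_tensorHom, Category.id_comp, Category.comp_id]
  rw [curry'_interp, curry'_interp, curry'_interp, comp_tensor, tensor_act]
  simp only [Category.assoc, A.comp_act, associator_naturality_assoc]
  monoidal

end Algebra

end Interpretation

namespace IsTheory

variable [IsLocallyPresentableMonoidal C κ]

lemma isRightAdjoint_forget (hT : T.IsTheory) : T.forget.IsRightAdjoint := by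
  refine Functor.isRightAdjoint_of_leftAdjointObjIsDefined_eq_top (eq_top_iff.2 fun X _ ↦ ?_)
  obtain ⟨K, _, _, ⟨p⟩⟩ :=
    (isCardinalFilteredGenerator_isCardinalPresentable C κ).exists_colimitsOfShape X
  have := HasCardinalFilteredColimits.hasColimitsOfShape C κ K
  have := hasColimitsOfShape_of_hasColimitsOfShape_createsColimitsOfShape (J := K) T.forget
  refine Functor.leftAdjointObjIsDefined_of_isColimit p.isColimit fun k ↦ ?_
  obtain ⟨F, η, hF, -⟩ := hT ⟨p.diag.obj k, p.prop_diag_obj k⟩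
  exact hF.corepresentableBy.isCorepresentable

lemma nonempty_freeAlgebras [∀ Z : C, (tensorRight Z).IsCardinalAccessible κ]
    (hT : T.IsTheory) : Nonempty T.FreeAlgebras := by
  have := hT.isRightAdjoint_forget
  let L : C ⥤ T.Algebra := T.forget.leftAdjoint
  let adj : L ⊣ T.forget := Adjunction.ofIsRightAdjoint T.forget
  have unit_naturality {X Y : C} (f : X ⟶ Y) :
      adj.unit.app X ≫ (L.map f).hom = f ≫ adj.unit.app Y :=
    (adj.unit.naturality f).symm
  have isFree_arity (Y : Arity C κ) : (L.obj Y.obj).IsFree (adj.unit.app Y.obj) := by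
    obtain ⟨F, η, hF, -⟩ := hT Y
    obtain ⟨e, he⟩ := hF.exists_iso_of_adjunction adj
    exact he ▸ hF.of_iso e
  refine ⟨⟨L, adj, fun X ↦ ?_⟩⟩
  obtain ⟨K, _, _, ⟨p⟩⟩ :=
    (isCardinalFilteredGenerator_isCardinalPresentable C κ).exists_colimitsOfShape X
  have (Z : C) : PreservesColimitsOfShape K (tensorRight Z) :=
    (tensorRight Z).preservesColimitsOfShape_of_isCardinalAccessible κ K
  have : PreservesColimitsOfSize.{w, w} L := adj.leftAdjoint_preservesColimits
  have := HasCardinalFilteredColimits.hasColimitsOfShape C κ K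
  exact Algebra.IsFree.of_isColimit p.isColimit
    (isColimitOfPreserves T.forget (isColimitOfPreserves L p.isColimit))
    (fun k ↦ adj.unit.app (p.diag.obj k)) (fun _ _ _ ↦ unit_naturality _) (adj.unit.app X)
    (fun _ ↦ unit_naturality _) (fun k ↦ isFree_arity ⟨p.diag.obj k, p.prop_diag_obj k⟩)

end IsTheory

namespace FreeAlgebras

variable (L : T.FreeAlgebras)

/-- The unit of the adjunction `F ⊣ U` at `X`, typed with the carrier of `FX` as its target. -/
def unit (X : C) : X ⟶ (L.F.obj X).carrier := L.adj.unit.app X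

lemma homEquiv_eq_unit_comp {X : C} {A : T.Algebra} (f : L.F.obj X ⟶ A) :
    L.adj.homEquiv X A f = L.unit X ≫ f.hom :=
  L.adj.homEquiv_unit _ _ f

lemma hom_ext {X : C} {A : T.Algebra} {f g : L.F.obj X ⟶ A}
    (h : L.unit X ≫ f.hom = L.unit X ≫ g.hom) : f = g :=
  (L.adj.homEquiv X A).injective (by rwa [homEquiv_eq_unit_comp, homEquiv_eq_unit_comp])

lemma unit_homOfOp {X Y : Arity C κ} (f : 𝟙_ C ⟶ T.cat.Hom X Y) :
    L.unit X.obj ≫ (L.homOfOp f).hom = (L.F.obj Y.obj).interp f (L.unit Y.obj) := by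
  rw [← homEquiv_eq_unit_comp]
  exact Equiv.apply_symm_apply _ _

lemma homOfOp_mapJ {X Y : Arity C κ} (f : X.obj ⟶ Y.obj) :
    L.homOfOp (T.mapJ f) = L.F.map f := by
  apply L.hom_ext
  rw [unit_homOfOp, Algebra.interp_mapJ]
  exact L.adj.unit.naturality f

lemma homOfOp_underlyingComp {X Y Z : Arity C κ} (f : 𝟙_ C ⟶ T.cat.Hom X Y)
    (g : 𝟙_ C ⟶ T.cat.Hom Y Z) :
    L.homOfOp (T.underlyingComp f g) = L.homOfOp f ≫ L.homOfOp g := by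
  apply L.hom_ext
  rw [unit_homOfOp, Algebra.interp_underlyingComp, ← unit_homOfOp, ← Algebra.interp_naturality,
    ← unit_homOfOp, Algebra.comp_hom, Category.assoc]

lemma isIso_eval_unit (hT : T.IsTheory) (X Y : Arity C κ) :
    IsIso ((L.F.obj Y.obj).eval X Y (L.unit Y.obj)) := by
  obtain ⟨F, η, hF, hη⟩ := hT Y
  obtain ⟨e, he⟩ := hF.exists_iso_of_adjunction L.adj
  have := hη X
  rw [unit, ← he, ← Algebra.eval_naturality]
  infer_instance

lemma homOfOp_bijective (hT : T.IsTheory) (X Y : Arity C κ) :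
    Function.Bijective (L.homOfOp : (𝟙_ C ⟶ T.cat.Hom X Y) → _) :=
  have := L.isIso_eval_unit hT X Y
  (L.adj.homEquiv _ _).symm.bijective.comp (MonoidalClosed.curryHomEquiv'.symm.bijective.comp
    (asIso ((L.F.obj Y.obj).eval X Y (L.unit Y.obj))).homToEquiv.bijective)

variable [IsLocallyPresentableMonoidal C κ]

lemma monad_isCardinalAccessible : L.monad.toFunctor.IsCardinalAccessible κ where
  preservesColimitOfShape K _ _ := by
    have := HasCardinalFilteredColimits.hasColimitsOfShape C κ K
    have : PreservesColimitsOfSize.{w, w} L.F := L.adj.leftAdjoint_preservesColimits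
    exact inferInstanceAs (PreservesColimitsOfShape K (L.F ⋙ T.forget))

variable [HasCoproducts.{w} C]

lemma isDiscrete_iff_surjections (hT : T.IsTheory) :
    T.IsDiscrete L ↔ ∀ X : Arity C κ, surjections C (L.monad.toFunctor.map (δ X.obj)) :=
  forall_congr' fun X ↦ calc
    _ ↔ ∀ φ : L.F.obj (𝟙_ C) ⟶ L.F.obj X.obj, ∃ g, g ≫ L.F.map (δ X.obj) = φ :=
      (L.homOfOp_bijective hT (Arity.unit C κ) X).surjective.forall.symm
    _ ↔ _ := (L.adj.homEquiv _ _).forall_congr fun φ ↦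
      (L.adj.homEquiv _ _).exists_congr fun g ↦ by
        rw [← (L.adj.homEquiv _ _).injective.eq_iff, Adjunction.homEquiv_naturality_right]
        rfl

lemma isDiscreteInside_iff_isDiscrete (hT : T.IsTheory)
    (h : ∀ X : Arity C κ, IsCardinalPresentable (discreteObj X.obj) κ) :
    T.IsDiscreteInside h ↔ T.IsDiscrete L := by
  refine forall₂_congr fun X f ↦ ?_
  let X₀ : Arity C κ := ⟨discreteObj X.obj, h X⟩
  calc
    _ ↔ ∃ g : 𝟙_ C ⟶ T.cat.Hom (Arity.unit C κ) X₀,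
        L.homOfOp g ≫ L.F.map (δ X.obj) = L.homOfOp f := exists_congr fun g ↦ by
      rw [← (L.homOfOp_bijective hT _ X).injective.eq_iff, homOfOp_underlyingComp, homOfOp_mapJ]
    _ ↔ ∃ φ : L.F.obj (𝟙_ C) ⟶ L.F.obj X₀.obj, φ ≫ L.F.map (δ X.obj) = L.homOfOp f :=
      ((L.homOfOp_bijective hT (Arity.unit C κ) X₀).surjective.exists
        (p := fun φ ↦ φ ≫ L.F.map (δ X.obj) = L.homOfOp f)).symm

end FreeAlgebras

end Pretheory

section Surjections

variable {C : Type u} [Category.{w} C] [MonoidalCategory C] [HasCoproducts.{w} C]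

lemma ι_δ (X : C) (x : 𝟙_ C ⟶ X) :
    (Sigma.ι (fun _ : 𝟙_ C ⟶ X ↦ 𝟙_ C) x : 𝟙_ C ⟶ discreteObj X) ≫ δ X = x :=
  Sigma.ι_desc _ _

lemma surjections_δ (X : C) : surjections C (δ X) :=
  fun x ↦ ⟨_, ι_δ X x⟩

lemma exists_discreteObj_lift {A B X : C} {q : A ⟶ B} (hq : surjections C q) (b : X ⟶ B) :
    ∃ a : discreteObj X ⟶ A, a ≫ q = δ X ≫ b := by
  choose r hr using hq
  refine ⟨Sigma.desc fun x ↦ r (x ≫ b), Sigma.hom_ext _ _ fun x ↦ ?_⟩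
  calc
    _ = r (x ≫ b) ≫ q := Sigma.ι_desc_assoc ..
    _ = x ≫ b := hr _
    _ = (Sigma.ι _ x ≫ δ X) ≫ b := by rw [ι_δ]
    _ = _ := Category.assoc ..

lemma preservesSurjections_iff_forall_arity {κ : Cardinal.{w}} [Fact κ.IsRegular]
    [IsLocallyPresentableMonoidal C κ] (G : C ⥤ C) [G.IsCardinalAccessible κ] :
    PreservesSurjections C G ↔ ∀ X : Arity C κ, surjections C (G.map (δ X.obj)) := by
  refine ⟨fun hG X ↦ hG _ (surjections_δ X.obj), fun hG A B q hq x ↦ ?_⟩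
  obtain ⟨K, _, _, ⟨p⟩⟩ :=
    (isCardinalFilteredGenerator_isCardinalPresentable C κ).exists_colimitsOfShape B
  have := G.preservesColimitsOfShape_of_isCardinalAccessible κ K
  have : IsCardinalPresentable (𝟙_ C) κ := IsLocallyPresentableMonoidal.unit_presentable
  obtain ⟨k, y, rfl⟩ : ∃ k y, y ≫ G.map (p.ι.app k) = x :=
    IsCardinalPresentable.exists_hom_of_isColimit κ (isColimitOfPreserves G p.isColimit) x
  obtain ⟨z, rfl⟩ := hG ⟨p.diag.obj k, p.prop_diag_obj k⟩ y
  obtain ⟨a, ha⟩ := exists_discreteObj_lift hq (p.ι.app k)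
  refine ⟨z ≫ G.map a, ?_⟩
  simp only [Category.assoc, ← G.map_comp, ha]

end Surjections

end DiscreteTheory

open DiscreteTheory in
theorem theorem3p4_general {C : Type u} [Category.{w} C] [MonoidalCategory C] [MonoidalClosed C]
    (κ : Cardinal.{w}) [Fact κ.IsRegular] [IsLocallyPresentableMonoidal C κ]
    [∀ Z : C, (tensorRight Z).IsCardinalAccessible κ] (T : Pretheory C κ) (hT : T.IsTheory) :
    Nonempty T.FreeAlgebras ∧
    ∀ L : T.FreeAlgebras,
      L.monad.toFunctor.IsCardinalAccessible κ ∧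
      (T.IsDiscrete L ↔ PreservesSurjections C L.monad.toFunctor) ∧
      ∀ h : ∀ X : Arity C κ, IsCardinalPresentable (discreteObj X.obj) κ,
        (T.IsDiscreteInside h ↔ PreservesSurjections C L.monad.toFunctor) := by
  refine ⟨hT.nonempty_freeAlgebras, fun L ↦ ?_⟩
  have := L.monad_isCardinalAccessible
  have discrete_iff : T.IsDiscrete L ↔ PreservesSurjections C L.monad.toFunctor :=
    (L.isDiscrete_iff_surjections hT).trans (preservesSurjections_iff_forall_arity _).symm
  exact ⟨this, discrete_iff, fun h ↦ (L.isDiscreteInside_iff_isDiscrete hT h).trans discrete_iff⟩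

theorem theorem3p4 {C : Type u} [CategoryTheory.Category.{w} C]
    [CategoryTheory.MonoidalCategory C] [CategoryTheory.SymmetricCategory C]
    [CategoryTheory.MonoidalClosed C]
    (κ : Cardinal.{w}) [Fact κ.IsRegular] [DiscreteTheory.IsLocallyPresentableMonoidal C κ]
    (T : DiscreteTheory.Pretheory C κ) (hT : T.IsTheory) :
    Nonempty T.FreeAlgebras ∧
    ∀ L : T.FreeAlgebras,
      L.monad.toFunctor.IsCardinalAccessible κ ∧
      (T.IsDiscrete L ↔ DiscreteTheory.PreservesSurjections C L.monad.toFunctor) ∧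
      ∀ h : ∀ X : DiscreteTheory.Arity C κ,
          CategoryTheory.IsCardinalPresentable (DiscreteTheory.discreteObj X.obj) κ,
        (T.IsDiscreteInside h ↔
          DiscreteTheory.PreservesSurjections C L.monad.toFunctor) :=
  theorem3p4_general κ T hT
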